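/- **Theorem 3.1.** Let $\mathbb K$ be an algebraically closed field of characteristic zero, let $n\ge 0$, and let $\varphi=(f_1,\dots,f_n):\mathbb A^n\to\mathbb A^n$, $f_i\in\mathbb K[x_1,\dots,x_n]$, be a polynomial map. Write $\varphi^*(H)=H(f_1,\dots,f_n)$ for a polynomial $H$ in $n$ variables, and let $|J(\varphi)|=\det(\partial f_i/\partial x_j)$. An irreducible subset $X\subseteq\mathbb A^n$ is called *contracted* by $\varphi$ if $\dim\varphi(X)<\dim X$ (the dimension of a set being that of its Zariski closure). For an irreducible polynomial $h\in\mathbb K[x_1,\dots,x_n]$, an *image polynomial* $\varphi_*(h)$ of $h$ is an irreducible polynomial $H$ in $n$ variables such that $h$ divides $\varphi^*(H)$. A hypersurface $X=V(h)$ with $h$ irreducible is called a *branching divisor* of $\varphi$ if $X$ is not contracted by $\varphi$, an image polynomial of $h$ exists, and $h^2$ divides $\varphi^*(H)$ for every image polynomial $H$ of $h$ (when $X$ is not contracted, $H$ is unique up to a nonzero constant factor). Then every irreducible component $X$ of the zero locus $\{a\in\mathbb A^n : |J(\varphi)|(a)=0\}$ is either contracted by $\varphi$ or is a branching divisor of $\varphi$.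 -/

import Mathlib

namespace PolyMap

open MvPolynomial

/-- The zero locus `V(h)` in `𝔸ⁿ = Kⁿ` of the polynomial `h`. -/
def hypersurface {K : Type*} [Field K] {n : ℕ} (h : MvPolynomial (Fin n) K) : Set (Fin n → K) :=
  {a | eval a h = 0}

/-- The Zariski topology on `𝔸ⁿ = Kⁿ`: the closed sets are the zero loci of ideals. -/
noncomputable abbrev zariski (K : Type*) [Field K] (n : ℕ) : TopologicalSpace (Fin n → K) :=
  TopologicalSpace.ofClosed
    {Z | ∃ I : Ideal (MvPolynomial (Fin n) K), zeroLocus K I = Z}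
    ⟨⊤, by simp⟩
    (by
      intro A hA
      refine ⟨⨆ I ∈ {I : Ideal (MvPolynomial (Fin n) K) | zeroLocus K I ∈ A}, I, ?_⟩
      apply le_antisymm
      · intro x hx Z hZ
        obtain ⟨I, rfl⟩ := hA hZ
        exact zeroLocus_anti_mono (le_iSup₂_of_le I hZ le_rfl) hx
      · intro x hx
        have hle : (⨆ I ∈ {I : Ideal (MvPolynomial (Fin n) K) | zeroLocus K I ∈ A}, I) ≤
            vanishingIdeal K {x} := by
          refine iSup₂_le fun I hI p hp => ?_
          rw [mem_vanishingIdeal_singleton_iff]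
          exact hx _ hI p hp
        intro p hp
        exact (mem_vanishingIdeal_singleton_iff x p).1 (hle hp))
    (by
      rintro _ ⟨I, rfl⟩ _ ⟨J, rfl⟩
      refine ⟨I * J, ?_⟩
      ext x
      constructor
      · intro hx
        by_contra hcon
        simp only [Set.mem_union, mem_zeroLocus_iff, not_or, not_forall] at hcon
        obtain ⟨⟨p, hp, hpx⟩, q, hq, hqx⟩ := hcon
        have := hx (p * q) (Ideal.mul_mem_mul hp hq)
        rw [map_mul] at this
        exact (mul_ne_zero hpx hqx) this
      · rintro (hx | hx)
        · exact zeroLocus_anti_mono Ideal.mul_le_left hx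
        · exact zeroLocus_anti_mono Ideal.mul_le_right hx)

/-- `X` is an irreducible component of `V ⊆ 𝔸ⁿ`: a maximal (Zariski-)irreducible subset of `V`.
(If `V` is closed, such an `X` is automatically closed.) -/
def IsComponent {K : Type*} [Field K] {n : ℕ} (V X : Set (Fin n → K)) : Prop :=
  Maximal (fun S : Set (Fin n → K) => @IsIrreducible _ (zariski K n) S ∧ S ⊆ V) X

/-- The dimension of a subset `S ⊆ 𝔸ⁿ`, that is, of its Zariski closure: the Krull dimension
of the coordinate ring `K[x] / I(S)`. It is `⊥` for the empty set. -/
noncomputable def dim {K : Type*} [Field K] {n : ℕ} (S : Set (Fin n → K)) : WithBot ℕ∞ :=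
  ringKrullDim (MvPolynomial (Fin n) K ⧸ vanishingIdeal K S)

/-- The polynomial map `φ = (f₁, …, fₙ) : 𝔸ⁿ → 𝔸ⁿ`. -/
noncomputable def toMap {K : Type*} [Field K] {n : ℕ} (f : Fin n → MvPolynomial (Fin n) K) :
    (Fin n → K) → (Fin n → K) :=
  fun a i => eval a (f i)

/-- The dual homomorphism `φ^* : H ↦ H(f₁, …, fₙ)`. -/
noncomputable def pullback {K : Type*} [Field K] {n : ℕ} (f : Fin n → MvPolynomial (Fin n) K) :
    MvPolynomial (Fin n) K →ₐ[K] MvPolynomial (Fin n) K :=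
  aeval f

/-- The Jacobian determinant `det (∂fᵢ/∂xⱼ)`. -/
noncomputable def jacobianDet {K : Type*} [Field K] {n : ℕ}
    (f : Fin n → MvPolynomial (Fin n) K) : MvPolynomial (Fin n) K :=
  (Matrix.of fun i j => pderiv j (f i)).det

/-- The irreducible variety `X` is contracted by `φ`: `dim φ(X) < dim X`. -/
def IsContracted {K : Type*} [Field K] {n : ℕ} (f : Fin n → MvPolynomial (Fin n) K)
    (X : Set (Fin n → K)) : Prop :=
  dim (toMap f '' X) < dim X

/-- `H` is an image polynomial `φ_*(h)` of `h`. -/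
def IsImagePolynomial {K : Type*} [Field K] {n : ℕ} (f : Fin n → MvPolynomial (Fin n) K)
    (h H : MvPolynomial (Fin n) K) : Prop :=
  Irreducible H ∧ h ∣ pullback f H

/-- `X = V(h)`, with `h` irreducible, is a branching divisor of `φ`: it is not contracted and
`h²` divides `φ^*(φ_*(h))`. As `φ_*(h)` is determined up to a nonzero constant when `X` is not
contracted, the condition is imposed on every image polynomial, and one is required to exist. -/
def IsBranchingDivisor {K : Type*} [Field K] {n : ℕ} (f : Fin n → MvPolynomial (Fin n) K)
    (X : Set (Fin n → K)) : Prop :=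
  ∃ h : MvPolynomial (Fin n) K, Irreducible h ∧ X = hypersurface h ∧ ¬ IsContracted f X ∧
    (∃ H, IsImagePolynomial f h H) ∧
    ∀ H, IsImagePolynomial f h H → h ^ 2 ∣ pullback f H

end PolyMap

open MvPolynomial

/-! Suppose `X` is not contracted, and let `Q = I(X)`, `A = K[x]/Q`. Comparing dimensions, `A` is
algebraic over the image of `φ^*`. Since the Jacobian matrix is singular over the domain `A`, it
kills some `v ≠ 0`; lifting `v` gives a vector field `D` on `𝔸ⁿ` with `D(fᵢ) ∈ Q`. Were `D` tangent
to `X`, it would induce a derivation of `A` vanishing on the image of `φ^*`, hence zero by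
algebraicity in characteristic zero, contradicting `v ≠ 0`. So `D` does not preserve `Q`. When `Q =
(h)`, this means `h ∤ D h`. If `φ^*(H) = h g`, then `D(φ^*(H)) = h D g + g D h` lies in `(h)`, which
forces `h ∣ g`. -/

/-! ### Krull dimension and transcendence degree -/

theorem ringKrullDim_eq_of_isIntegral {R S : Type*} [CommRing R] [CommRing S] [IsDomain S]
    [Algebra R S] [Algebra.IsIntegral R S] [FaithfulSMul R S] :
    ringKrullDim R = ringKrullDim S := by
  have hinj := FaithfulSMul.algebraMap_injective R S
  have := hinj.isDomain
  apply le_antisymm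
  · refine iSup_le fun l => ?_
    obtain ⟨Q, -, hQ, hQl⟩ := Ideal.exists_ideal_over_prime_of_isIntegral
      l.head.asIdeal (⊥ : Ideal S) (by
        rw [← RingHom.ker_eq_comap_bot, (RingHom.injective_iff_ker_eq_bot _).1 hinj]
        exact bot_le)
    have : Q.LiesOver l.head.asIdeal := ⟨hQl.symm⟩
    obtain ⟨L, hL, -⟩ := Ideal.exists_ltSeries_of_hasGoingUp (S := S) l Q
    rw [← hL]
    exact Order.LTSeries.length_le_krullDim L
  · exact Order.krullDim_le_of_strictMono (PrimeSpectrum.comap (algebraMap R S))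
      fun P P' h => Ideal.IsIntegral.comap_lt_comap (R := R) h

/-- Noether normalization: both invariants are read off from the same polynomial subring. -/
theorem exists_ringKrullDim_eq_and_trdeg_eq (K A : Type*) [Field K] [CommRing A] [IsDomain A]
    [Algebra K A] [Algebra.FiniteType K A] :
    ∃ s : ℕ, ringKrullDim A = s ∧ Algebra.trdeg K A = s := by
  obtain ⟨s, g, hg, hint⟩ := exists_integral_inj_algHom_of_fg K A
  refine ⟨s, ?_, ?_⟩
  · algebraize [g.toRingHom]
    have : FaithfulSMul (MvPolynomial (Fin s) K) A := (faithfulSMul_iff_algebraMap_injective _ _).2 hg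
    have := ringKrullDim_eq_of_isIntegral (R := MvPolynomial (Fin s) K) (S := A)
    rw [← this, ringKrullDim_of_isNoetherianRing]
    simp
  · algebraize [g.toRingHom]
    have : FaithfulSMul (MvPolynomial (Fin s) K) A := (faithfulSMul_iff_algebraMap_injective _ _).2 hg
    have h := ((IsTranscendenceBasis.mvPolynomial (Fin s) K).algebraMap_comp
      (A := A)).lift_cardinalMk_eq_trdeg
    simpa using h.symm

theorem isAlgebraic_range_of_ringKrullDim_le {K : Type*} {R A : Type*} [Field K] [CommRing R]
    [Algebra K R] [Algebra.FiniteType K R] [CommRing A] [IsDomain A] [Algebra K A]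
    [Algebra.FiniteType K A] (g : R →ₐ[K] A)
    (h : ringKrullDim A ≤ ringKrullDim (R ⧸ RingHom.ker g)) : Algebra.IsAlgebraic g.range A := by
  have e := Ideal.quotientKerEquivRange g
  have : Algebra.FiniteType K g.range :=
    Algebra.FiniteType.of_surjective g.rangeRestrict g.rangeRestrict_surjective
  obtain ⟨s, hs, hs'⟩ := exists_ringKrullDim_eq_and_trdeg_eq K A
  obtain ⟨t, ht, ht'⟩ := exists_ringKrullDim_eq_and_trdeg_eq K g.range
  have e' := ringKrullDim_eq_of_ringEquiv e.toRingEquiv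
  rw [e'.trans ht, hs] at h
  have hst : s ≤ t := by exact_mod_cast h
  have hadd := trdeg_add_eq K g.range (A := A)
  rw [ht', hs'] at hadd
  have hlt : Algebra.trdeg g.range A < Cardinal.aleph0 :=
    (self_le_add_left _ _).trans_lt (hadd ▸ Cardinal.natCast_lt_aleph0)
  obtain ⟨r, hr⟩ := Cardinal.lt_aleph0.1 hlt
  rw [hr] at hadd
  have : t + r = s := by exact_mod_cast hadd
  rw [← trdeg_eq_zero_iff, hr, show r = 0 by lia, Nat.cast_zero]

theorem ringKrullDim_le_of_injective_algHom {K : Type*} {A B : Type*} [Field K] [CommRing B]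
    [IsDomain B] [Algebra K B] [Algebra.FiniteType K B] [CommRing A] [IsDomain A] [Algebra K A]
    [Algebra.FiniteType K A] (g : B →ₐ[K] A) (hg : Function.Injective g) :
    ringKrullDim B ≤ ringKrullDim A := by
  obtain ⟨s, hs, hs'⟩ := exists_ringKrullDim_eq_and_trdeg_eq K A
  obtain ⟨t, ht, ht'⟩ := exists_ringKrullDim_eq_and_trdeg_eq K B
  have h := lift_trdeg_le_of_injective g hg
  rw [hs', ht'] at h
  rw [hs, ht]
  simp only [Cardinal.lift_natCast, Nat.cast_le] at h
  exact_mod_cast h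

/-! ### Derivations and algebraic extensions -/

/-- Differentiating `p(a) = 0` gives `p'(a) * D a = 0`; if `p'(a) = 0`, descend to `p'`, which is
nonzero in characteristic zero. -/
theorem Derivation.apply_eq_zero_of_aeval_eq_zero {B A : Type*} [CommRing B] [CommRing A]
    [IsDomain A] [CharZero A] [Algebra B A] [FaithfulSMul B A] (D : Derivation B A A) (a : A) :
    ∀ p : Polynomial B, p ≠ 0 → Polynomial.aeval a p = 0 → D a = 0 := by
  have hinj := FaithfulSMul.algebraMap_injective B A
  have := hinj.isDomain
  have : CharZero B := (RingHom.charZero_iff hinj).2 ‹_›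
  intro p
  induction hn : p.natDegree using Nat.strong_induction_on generalizing p with
  | _ n ih =>
    subst hn
    intro hp hpa
    have h0 : p.natDegree ≠ 0 := by
      intro h
      rw [Polynomial.eq_C_of_natDegree_eq_zero h] at hp hpa
      rw [Polynomial.aeval_C, map_eq_zero_iff _ hinj] at hpa
      exact hp (by rw [hpa, map_zero])
    have h := D.map_aeval p a
    rw [hpa, map_zero, smul_eq_mul, eq_comm, mul_eq_zero] at h
    refine h.elim (fun h => ih _ (Polynomial.natDegree_derivative_lt h0) _ rfl ?_ h) id
    exact fun h => h0 (Polynomial.derivative_eq_zero.1 h)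

theorem Derivation.eq_zero_of_isAlgebraic {K A : Type*} [Field K] [CommRing A] [IsDomain A]
    [CharZero A] [Algebra K A] (B : Subalgebra K A) [Algebra.IsAlgebraic B A]
    (D : Derivation K A A) (hD : ∀ b ∈ B, D b = 0) : D = 0 := by
  let D' : Derivation B A A :=
    { toFun := D
      map_add' := map_add D
      map_smul' := fun b a => by
        simp [Subalgebra.smul_def, hD b b.2]
      map_one_eq_zero' := D.map_one_eq_zero
      leibniz' := D.leibniz }
  ext a
  obtain ⟨p, hp, hpa⟩ := Algebra.IsAlgebraic.isAlgebraic (R := B) a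
  exact D'.apply_eq_zero_of_aeval_eq_zero a p hp hpa

namespace PolyMap

variable {K : Type*} [Field K] {n : ℕ}

/-! ### The transversal vector field -/

theorem mkDerivation_apply_eq_sum {A : Type*} [CommRing A] [Algebra K A]
    [Algebra (MvPolynomial (Fin n) K) A] [IsScalarTower K (MvPolynomial (Fin n) K) A]
    (v : Fin n → A) (p : MvPolynomial (Fin n) K) :
    mkDerivation K v p = ∑ j, pderiv j p • v j := by
  classical
  induction p using MvPolynomial.induction_on with
  | C a => simp
  | add p q hp hq => simp [hp, hq, add_smul, Finset.sum_add_distrib]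
  | mul_X p i h =>
    simp [h, Pi.single_apply, add_smul, Finset.sum_add_distrib, Finset.smul_sum, mul_smul]

theorem derivation_pullback_mem (f : Fin n → MvPolynomial (Fin n) K)
    (Q : Ideal (MvPolynomial (Fin n) K))
    (D : Derivation K (MvPolynomial (Fin n) K) (MvPolynomial (Fin n) K))
    (hD : ∀ i, D (f i) ∈ Q) (H : MvPolynomial (Fin n) K) : D (pullback f H) ∈ Q := by
  induction H using MvPolynomial.induction_on with
  | C a => simp [pullback]
  | add p q hp hq => rw [map_add, map_add]; exact Q.add_mem hp hq
  | mul_X p i h =>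
    rw [map_mul, D.leibniz, smul_eq_mul, smul_eq_mul]
    refine Q.add_mem (Q.mul_mem_left _ ?_) (Q.mul_mem_left _ h)
    simpa [pullback] using hD i

/-- If the Jacobian determinant vanishes along a variety which is not contracted, then
there is a vector field in the kernel of the differential which is not tangent to it. -/
theorem exists_derivation_of_jacobianDet_mem [CharZero K] (f : Fin n → MvPolynomial (Fin n) K)
    (Q : Ideal (MvPolynomial (Fin n) K)) [Q.IsPrime] (hJ : jacobianDet f ∈ Q)
    (hdim : ringKrullDim (MvPolynomial (Fin n) K ⧸ Q) ≤
      ringKrullDim (MvPolynomial (Fin n) K ⧸ Q.comap (pullback f))) :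
    ∃ D : Derivation K (MvPolynomial (Fin n) K) (MvPolynomial (Fin n) K),
      (∀ i, D (f i) ∈ Q) ∧ ∃ q ∈ Q, D q ∉ Q := by
  set A := MvPolynomial (Fin n) K ⧸ Q
  have : CharZero A := charZero_of_injective_algebraMap (algebraMap K A).injective
  let π : MvPolynomial (Fin n) K →ₐ[K] A := Ideal.Quotient.mkₐ K Q
  have hπ : Function.Surjective π := Ideal.Quotient.mkₐ_surjective K Q
  have hπ0 (p) : π p = 0 ↔ p ∈ Q := Ideal.Quotient.eq_zero_iff_mem
  have hker : RingHom.ker (π.comp (pullback f)) = Q.comap (pullback f) := by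
    ext p
    simp [RingHom.mem_ker, hπ0]
  have halg : Algebra.IsAlgebraic (π.comp (pullback f)).range A :=
    isAlgebraic_range_of_ringKrullDim_le _ (by rwa [hker])
  have hdet : (Matrix.of fun i j => π (pderiv j (f i))).det = 0 := by
    rw [← (hπ0 _).2 hJ, jacobianDet]
    exact (π.toRingHom.map_det _).symm
  obtain ⟨v, hv, hJv⟩ := Matrix.exists_mulVec_eq_zero_iff.2 hdet
  choose w hw using fun j => hπ (v j)
  refine ⟨mkDerivation K w, fun i => ?_, ?_⟩
  · rw [← hπ0, mkDerivation_apply_eq_sum, map_sum]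
    simpa [Matrix.mulVec, dotProduct, hw] using congrFun hJv i
  -- If `D` maps `Q` into itself, it descends to `A`.
  · by_contra! hcon
    let D := mkDerivation K w
    have hD : ∀ x, π x = 0 → π (D x) = 0 := fun x hx => (hπ0 _).2 (hcon x ((hπ0 _).1 hx))
    have hzero := Derivation.eq_zero_of_isAlgebraic (π.comp (pullback f)).range
      (Derivation.liftOfSurjective hπ hD) (by
        rintro _ ⟨p, rfl⟩
        refine (Derivation.liftOfSurjective_apply hπ hD _).trans ?_
        rw [hπ0]
        refine derivation_pullback_mem f Q D (fun i => ?_) p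
        rw [← hπ0, mkDerivation_apply_eq_sum, map_sum]
        simpa [Matrix.mulVec, dotProduct, hw] using congrFun hJv i)
    refine hv (funext fun j => ?_)
    have h := Derivation.liftOfSurjective_apply hπ hD (X j)
    rw [hzero] at h
    rw [Pi.zero_apply, ← hw, ← mkDerivation_X K w j]
    exact h.symm

/-! ### Zariski topology and components -/

theorem vanishingIdeal_image (f : Fin n → MvPolynomial (Fin n) K) (S : Set (Fin n → K)) :
    vanishingIdeal K (toMap f '' S) = (vanishingIdeal K S).comap (pullback f) := by
  ext p
  have h (x : Fin n → K) : eval x (pullback f p) = eval (toMap f x) p := by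
    induction p using MvPolynomial.induction_on with
    | C a => simp [pullback]
    | add p q hp hq => simp [hp, hq]
    | mul_X p i h => rw [map_mul, map_mul, map_mul, h]; simp [pullback, toMap]
  simp [mem_vanishingIdeal_iff, aeval_eq_eval, h]

theorem hypersurface_eq_zeroLocus (h : MvPolynomial (Fin n) K) :
    hypersurface h = zeroLocus K (Ideal.span {h}) := by
  ext x
  simp [hypersurface, zeroLocus_span, aeval_eq_eval]

theorem isClosed_zariski_iff {Z : Set (Fin n → K)} :
    @IsClosed _ (zariski K n) Z ↔ ∃ I : Ideal (MvPolynomial (Fin n) K), zeroLocus K I = Z := by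
  rw [← @isOpen_compl_iff _ Z (zariski K n)]
  change Zᶜᶜ ∈ {Z | ∃ I : Ideal (MvPolynomial (Fin n) K), zeroLocus K I = Z} ↔ _
  rw [compl_compl]
  rfl

theorem isPrime_vanishingIdeal_of_isIrreducible {X : Set (Fin n → K)}
    (hX : @IsIrreducible _ (zariski K n) X) : (vanishingIdeal K X).IsPrime := by
  let := zariski K n
  refine ⟨fun h => ?_, fun {p q} hpq => ?_⟩
  · obtain ⟨x, hx⟩ := hX.1
    simpa using (h ▸ Submodule.mem_top : (1 : MvPolynomial (Fin n) K) ∈ vanishingIdeal K X) x hx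
  · have key (r : MvPolynomial (Fin n) K) :
        X ⊆ hypersurface r → r ∈ vanishingIdeal K X := fun h x hx => by
      simpa [hypersurface, aeval_eq_eval] using h hx
    refine (isPreirreducible_iff_isClosed_union_isClosed.1 hX.2 (hypersurface p) (hypersurface q)
      ?_ ?_ fun x hx => ?_).imp (key p) (key q)
    · rw [hypersurface_eq_zeroLocus]; exact isClosed_zariski_iff.2 ⟨_, rfl⟩
    · rw [hypersurface_eq_zeroLocus]; exact isClosed_zariski_iff.2 ⟨_, rfl⟩
    · simpa [hypersurface, aeval_eq_eval] using hpq x hx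

theorem isIrreducible_zeroLocus [IsAlgClosed K] (P : Ideal (MvPolynomial (Fin n) K))
    [hP : P.IsPrime] : @IsIrreducible _ (zariski K n) (zeroLocus K P) := by
  let := zariski K n
  refine ⟨?_, isPreirreducible_iff_isClosed_union_isClosed.2 ?_⟩
  · rw [Set.nonempty_iff_ne_empty]
    intro h
    have := MvPolynomial.IsPrime.vanishingIdeal_zeroLocus (K := K) P
    rw [h, vanishingIdeal_empty] at this
    exact hP.ne_top this.symm
  · intro z₁ z₂ h₁ h₂ h
    obtain ⟨I, rfl⟩ := isClosed_zariski_iff.1 h₁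
    obtain ⟨J, rfl⟩ := isClosed_zariski_iff.1 h₂
    have hIJ : I * J ≤ P := by
      rw [← MvPolynomial.IsPrime.vanishingIdeal_zeroLocus (K := K) P,
        ← le_zeroLocus_iff_le_vanishingIdeal]
      refine h.trans (Set.union_subset ?_ ?_)
      · exact zeroLocus_anti_mono Ideal.mul_le_left
      · exact zeroLocus_anti_mono Ideal.mul_le_right
    exact (hP.mul_le.1 hIJ).imp zeroLocus_anti_mono zeroLocus_anti_mono

/-- A component of a proper hypersurface is the zero locus of a prime polynomial. -/
theorem IsComponent.eq_hypersurface [IsAlgClosed K] {J : MvPolynomial (Fin n) K}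
    {X : Set (Fin n → K)} (hX : IsComponent (hypersurface J) X) (hJ : J ≠ 0) :
    ∃ h, Prime h ∧ X = hypersurface h ∧ vanishingIdeal K X = Ideal.span {h} := by
  have hprime := isPrime_vanishingIdeal_of_isIrreducible hX.1.1
  have hJX : J ∈ vanishingIdeal K X := fun x hx => by
    simpa [hypersurface, aeval_eq_eval] using hX.1.2 hx
  obtain ⟨h, hJh, hX', hh⟩ : ∃ h, h ∣ J ∧ h ∈ vanishingIdeal K X ∧ Prime h := by
    obtain ⟨s, hs, u, hu⟩ := UniqueFactorizationMonoid.exists_prime_factors J hJ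
    rw [← hu] at hJX
    obtain ⟨h, hhs, hhX⟩ := (hprime.multiset_prod_mem_iff_exists_mem s).1
      ((hprime.mem_or_mem hJX).resolve_right
        fun h => hprime.ne_top (Ideal.eq_top_of_isUnit_mem _ h u.isUnit))
    exact ⟨h, (Multiset.dvd_prod hhs).trans ⟨u, hu.symm⟩, hhX, hs h hhs⟩
  have := (Ideal.span_singleton_prime hh.ne_zero).2 hh
  have hXh : X = hypersurface h := by
    refine hX.eq_of_subset ⟨?_, fun x hx => ?_⟩ fun x hx => ?_
    · rw [hypersurface_eq_zeroLocus]
      exact isIrreducible_zeroLocus _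
    · obtain ⟨c, rfl⟩ := hJh
      simp_all [hypersurface]
    · simpa [hypersurface, aeval_eq_eval] using hX' x hx
  refine ⟨h, hh, hXh, ?_⟩
  rw [hXh, hypersurface_eq_zeroLocus]
  exact MvPolynomial.IsPrime.vanishingIdeal_zeroLocus _

/-- Otherwise `K[x]` would embed in `K[x]/(h)`, which has smaller dimension. This supplies the image
polynomial. -/
theorem comap_pullback_ne_bot (f : Fin n → MvPolynomial (Fin n) K)
    (Q : Ideal (MvPolynomial (Fin n) K)) [hQ : Q.IsPrime] {h : MvPolynomial (Fin n) K}
    (h0 : h ≠ 0) (hQh : Q = Ideal.span {h}) : Q.comap (pullback f) ≠ ⊥ := by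
  intro hbot
  let g : MvPolynomial (Fin n) K →ₐ[K] MvPolynomial (Fin n) K ⧸ Q :=
    (Ideal.Quotient.mkₐ K Q).comp (pullback f)
  have hg : Function.Injective g := by
    refine (injective_iff_map_eq_zero g).2 fun p hp => ?_
    rw [← Ideal.mem_bot, ← hbot]
    exact Ideal.mem_comap.2 ((Ideal.Quotient.eq_zero_iff_mem (I := Q)).1 hp)
  have h1 := ringKrullDim_le_of_injective_algHom g hg
  have h2 := ringKrullDim_quotient_succ_le_of_nonZeroDivisor (mem_nonZeroDivisors_of_ne_zero h0)
  rw [← hQh] at h2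
  obtain ⟨s, hs, -⟩ := exists_ringKrullDim_eq_and_trdeg_eq K (MvPolynomial (Fin n) K)
  obtain ⟨t, ht, -⟩ := exists_ringKrullDim_eq_and_trdeg_eq K (MvPolynomial (Fin n) K ⧸ Q)
  rw [hs, ht] at h1 h2
  have h1' : s ≤ t := by exact_mod_cast h1
  have h2' : t + 1 ≤ s := by exact_mod_cast h2
  lia

end PolyMap

open PolyMap in
theorem theorem3p1 {K : Type*} [Field K] [IsAlgClosed K] [CharZero K] (n : ℕ)
    (f : Fin n → MvPolynomial (Fin n) K) (X : Set (Fin n → K))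
    (hX : PolyMap.IsComponent (PolyMap.hypersurface (PolyMap.jacobianDet f)) X) :
    PolyMap.IsContracted f X ∨ PolyMap.IsBranchingDivisor f X := by
  refine or_iff_not_imp_left.2 fun hc => ?_
  have hprime := isPrime_vanishingIdeal_of_isIrreducible hX.1.1
  have hdim := not_lt.1 hc
  rw [dim, dim, vanishingIdeal_image] at hdim
  obtain ⟨D, hDf, q, hq, hDq⟩ := exists_derivation_of_jacobianDet_mem f (vanishingIdeal K X)
    (fun x hx => by simpa [hypersurface, aeval_eq_eval] using hX.1.2 hx) hdim
  -- If the Jacobian is identically zero, then `X = 𝔸ⁿ` and `Q = 0`, so no `q ∈ Q` has `D q ∉ Q`.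
  by_cases hJ : jacobianDet f = 0
  · have hX' : X = Set.univ := by
      refine hX.eq_of_subset ⟨?_, ?_⟩ (Set.subset_univ X)
      · simpa using isIrreducible_zeroLocus (⊥ : Ideal (MvPolynomial (Fin n) K))
      · simp [hJ, hypersurface]
    have h0 : q = 0 := funext fun x => by
      simpa [aeval_eq_eval] using hq x (hX' ▸ Set.mem_univ x)
    simp [h0] at hDq
  obtain ⟨h, hh, hXh, hId⟩ := hX.eq_hypersurface hJ
  refine ⟨h, hh.irreducible, hXh, hc, ?_, ?_⟩
  · obtain ⟨H, hH, hHp⟩ := Ideal.IsPrime.exists_mem_prime_of_ne_bot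
      (hprime.comap (pullback f)) (comap_pullback_ne_bot f _ hh.ne_zero hId)
    exact ⟨H, hHp.irreducible, Ideal.mem_span_singleton.1 (hId ▸ Ideal.mem_comap.1 hH)⟩
  · rintro H ⟨-, g, hg⟩
    have hDH := derivation_pullback_mem f _ D hDf H
    rw [hId] at hDH hq hDq
    obtain ⟨r, rfl⟩ := Ideal.mem_span_singleton.1 hq
    rw [hg] at hDH ⊢
    simp only [Derivation.leibniz, smul_eq_mul, Ideal.mem_span_singleton] at hDH hDq
    -- Modulo `h`, the two Leibniz expansions reduce to `h ∣ g * D h` and `h ∤ r * D h`.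
    rw [dvd_add_right (dvd_mul_right _ _)] at hDH hDq
    rw [pow_two]
    exact mul_dvd_mul_left h
      ((hh.dvd_or_dvd hDH).resolve_right fun hd => hDq (hd.mul_left r))
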